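/- Let $M$ be a connected, Hausdorff, second-countable $C^\infty$ manifold (without boundary) of finite dimension at least $1$. A Finsler structure on $M$ is a continuous function $F:TM\to[0,+\infty)$, of class $C^\infty$ on $TM\setminus\{0\}$, such that for each $x\in M$ the function $F(x,\cdot)$ is a Minkowski norm on $T_xM$: it vanishes only at $0$, it satisfies the triangle inequality, $F(x,cv)=cF(x,v)$ for $c\ge 0$, it is continuous on $T_xM$ and $C^\infty$ on $T_xM\setminus\{0\}$, and for each $v\ne 0$ the quadratic form $w\mapsto\frac12\,\mathrm{d}^2(F(x,\cdot)^2)_v[w,w]$ is positive definite. It is reversible if $F(x,-v)=F(x,v)$ for all $x\in M$, $v\in T_xM$. The Finsler length of a curve $\gamma$ on $[a,b]$ is $\int_a^b F(\gamma_t,\dot\gamma_t)\,\mathrm{d}t$, and the Finsler distance $\mathsf d_F(x,y)$ is the infimum of the lengths of the piecewise $C^1$ curves $\gamma:[0,1]\to M$ with $\gamma_0=x$ and $\gamma_1=y$. A geodesic is a $C^1$ curve, defined on an open interval, that is locally a stationary point of the length functional (under variations with fixed end points). $(M,F)$ is geodesically complete if every constant speed geodesic can be extended to a geodesic defined on the whole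 real line. Balls $B_r(x)=\{y:\mathsf d_F(x,y)<r\}$, neighbourhoods $B_r(S)=\bigcup_{x\in S}B_r(x)$ and the Lipschitz property refer to $\mathsf d_F$. For $h:M\to\mathbb R$ and $S\subseteq M$ put $$\mathrm{Lip}(h;S)=\sup\Big\{\frac{|h(x)-h(y)|}{\mathsf d_F(x,y)}\;:\;x,y\in S,\ x\ne y\Big\}\in[0,+\infty],\qquad \mathrm{lip}_a(h)(x)=\inf_{r>0}\mathrm{Lip}(h;B_r(x)),$$ and let $\mathrm{spt}(h)$ be the closure of $\{h\neq 0\}$. Theorem. Let $(M,F)$ be a geodesically complete, reversible Finsler manifold of dimension at least $1$, let $f:M\to\mathbb R$ be a Lipschitz function and let $\delta,\varepsilon,\lambda>0$. Then there is a function $g\in C^1(M)$ with $\mathrm{spt}(g)\subseteq B_\delta(\mathrm{spt}(f))$ such that, for every $x\in M$, $$|g(x)-f(x)|\le\varepsilon\qquad\text{and}\qquad \mathrm{lip}_a(g)(x)\le\mathrm{Lip}\big(f;B_\delta(x)\big)+\lambda .$$ -/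

import Mathlib

open scoped Manifold ContDiff ENNReal

noncomputable section

/-! ### Minkowski norms and Finsler structures -/

/-- A Minkowski norm on a finite-dimensional real vector space `V`. The norm that `V` carries as a
normed space only serves to speak of derivatives; all norms on `V` give the same notion. -/
structure IsMinkowskiNorm {V : Type*} [NormedAddCommGroup V] [NormedSpace ℝ V] (F : V → ℝ) :
    Prop where
  nonneg : ∀ v, 0 ≤ F v
  eq_zero_iff : ∀ v, F v = 0 ↔ v = 0
  triangle : ∀ v w, F (v + w) ≤ F v + F w
  smul : ∀ (c : ℝ) (v : V), 0 ≤ c → F (c • v) = c * F v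
  continuous : Continuous F
  smooth : ContDiffOn ℝ ∞ F {0}ᶜ
  /-- the quadratic form `w ↦ ½ d²(F²)_v[w, w]` is positive definite for every `v ≠ 0` -/
  strongConvex : ∀ v, v ≠ 0 → ∀ w, w ≠ 0 →
    0 < (1 / 2 : ℝ) * fderiv ℝ (fderiv ℝ (fun u => F u ^ 2)) v w w

section Finsler

variable (E : Type*) [NormedAddCommGroup E] [NormedSpace ℝ E]
  (M : Type*) [TopologicalSpace M] [ChartedSpace E M] [IsManifold 𝓘(ℝ, E) ∞ M]

/-- A Finsler structure on the manifold `M` modelled on `E`: a continuous function on the tangent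
bundle, smooth away from the zero section, whose restriction to each tangent space (which is the
vector space `E`) is a Minkowski norm. -/
structure FinslerStructure where
  /-- the function `F (x, v)` -/
  toFun : ∀ x : M, TangentSpace 𝓘(ℝ, E) x → ℝ
  continuous : Continuous fun p : TangentBundle 𝓘(ℝ, E) M => toFun p.proj p.snd
  smooth : ContMDiffOn 𝓘(ℝ, E).tangent 𝓘(ℝ, ℝ) ∞
    (fun p : TangentBundle 𝓘(ℝ, E) M => toFun p.proj p.snd) {p | p.snd ≠ 0}
  minkowski : ∀ x : M, IsMinkowskiNorm (V := E) (toFun x)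

variable {E M}

namespace FinslerStructure

/-- The Finsler structure is reversible: `F (x, -v) = F (x, v)`. -/
def Reversible (F : FinslerStructure E M) : Prop :=
  ∀ (x : M) (v : TangentSpace 𝓘(ℝ, E) x), F.toFun x (-v) = F.toFun x v

/-- The speed `F (γ t, γ' t)` of a curve. -/
def speed (F : FinslerStructure E M) (γ : ℝ → M) (t : ℝ) : ℝ :=
  F.toFun (γ t) (mfderiv 𝓘(ℝ, ℝ) 𝓘(ℝ, E) γ t (1 : ℝ))

/-- The Finsler length of `γ` restricted to `[a, b]`. -/
def length (F : FinslerStructure E M) (γ : ℝ → M) (a b : ℝ) : ℝ :=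
  ∫ t in a..b, F.speed γ t

end FinslerStructure

/-- `γ` restricted to `[0, 1]` is piecewise `C¹`: there is a subdivision
`0 = t 0 ≤ t 1 ≤ … ≤ t n = 1` such that `γ` is `C¹`, up to the end points, on each
`[t i, t (i + 1)]`. In particular `γ` is continuous on `[0, 1]`. -/
def IsPiecewiseC1 (E : Type*) [NormedAddCommGroup E] [NormedSpace ℝ E]
    {M : Type*} [TopologicalSpace M] [ChartedSpace E M] (γ : ℝ → M) : Prop :=
  ∃ (n : ℕ) (t : ℕ → ℝ), Monotone t ∧ t 0 = 0 ∧ t n = 1 ∧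
    ∀ i < n, ContMDiffOn 𝓘(ℝ, ℝ) 𝓘(ℝ, E) 1 γ (Set.Icc (t i) (t (i + 1)))

namespace FinslerStructure

/-- The Finsler distance: the infimum of the lengths of the piecewise `C¹` curves `[0, 1] → M`
from `x` to `y`. -/
def fdist (F : FinslerStructure E M) (x y : M) : ℝ :=
  sInf {l : ℝ | ∃ γ : ℝ → M, IsPiecewiseC1 E γ ∧ γ 0 = x ∧ γ 1 = y ∧ l = F.length γ 0 1}

/-- `γ` is a Finsler geodesic on the open interval `J`: it is `C¹` and locally a stationary point
of the length functional. That is, each time `t₀ ∈ J` has a compact neighbourhood `[a, b] ⊆ J`,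
mapped by `γ` into the chart around `γ t₀`, such that for every `C¹` field `η` vanishing at `a` and
`b` the length on `[a, b]` of the curve which reads `γ + s η` in the chart has zero derivative
at `s = 0`. -/
def IsGeodesicOn (F : FinslerStructure E M) (γ : ℝ → M) (J : Set ℝ) : Prop :=
  ContMDiffOn 𝓘(ℝ, ℝ) 𝓘(ℝ, E) 1 γ J ∧
  ∀ t₀ ∈ J, ∃ a b : ℝ, a < t₀ ∧ t₀ < b ∧ Set.Icc a b ⊆ J ∧
    Set.MapsTo γ (Set.Icc a b) (chartAt E (γ t₀)).source ∧
    ∀ η : ℝ → E, ContDiff ℝ 1 η → η a = 0 → η b = 0 →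
      HasDerivAt (fun s : ℝ => F.length
        (fun t => (chartAt E (γ t₀)).symm (chartAt E (γ t₀) (γ t) + s • η t)) a b) 0 0

/-- Geodesic completeness: every constant speed geodesic, defined on a nonempty open interval `J`,
can be extended to a geodesic defined on the whole real line. -/
def GeodesicallyComplete (F : FinslerStructure E M) : Prop :=
  ∀ (J : Set ℝ) (γ : ℝ → M), IsOpen J → J.OrdConnected → J.Nonempty → F.IsGeodesicOn γ J →
    (∃ c : ℝ, ∀ t ∈ J, F.speed γ t = c) →
    ∃ γ' : ℝ → M, F.IsGeodesicOn γ' Set.univ ∧ Set.EqOn γ' γ J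

end FinslerStructure

end Finsler

/-! ### Lipschitz constants with respect to a distance function `d` -/

section Lipschitz

variable {X : Type*} (d : X → X → ℝ)

/-- The open ball `B_r(x)`. -/
def openBall (x : X) (r : ℝ) : Set X := {y | d x y < r}

/-- The `r`-neighbourhood `B_r(S)` of a set `S`, the union of the balls `B_r(x)`, `x ∈ S`. -/
def nbhd (S : Set X) (r : ℝ) : Set X := {y | ∃ x ∈ S, d x y < r}

/-- `f` is a Lipschitz function. -/
def IsLipschitz (f : X → ℝ) : Prop := ∃ K : ℝ, ∀ x y, |f x - f y| ≤ K * d x y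

/-- The Lipschitz constant `Lip(f; S)` of `f` restricted to `S`, possibly `∞`. -/
def lipConst (f : X → ℝ) (S : Set X) : ℝ≥0∞ :=
  ⨆ (x ∈ S) (y ∈ S) (_ : x ≠ y), ENNReal.ofReal (|f x - f y| / d x y)

open Classical in
/-- The asymptotic Lipschitz constant `lip_a(f)(x)`: the infimum over `r > 0` of `Lip(f; B_r(x))`
at an accumulation point `x`, and `∞` at an isolated point. -/
def asympLip (f : X → ℝ) (x : X) : ℝ≥0∞ :=
  if ∀ r : ℝ, 0 < r → ∃ y ∈ openBall d x r, y ≠ x then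
    ⨅ (r : ℝ) (_ : 0 < r), lipConst d f (openBall d x r)
  else ⊤

end Lipschitz

end

/-! Near a point `p` the manifold is almost a Minkowski space. By continuity of the Finsler
structure, in a small chart ball the norms `F x` lie within factors `1 ± η` of the single norm `N =
F p`, and hence `fdist` lies within the same factors of `N (v - u)` (`exists_fdist_bounds`). The
upper bound measures straight segments. The lower bound is a calibration argument: a linear
functional supporting `N` at the displacement grows along any curve no faster than its length, and a
curve that leaves the chart ball is already long enough (`displacement_le_length`).

The distance `N (v - u)` is translation invariant, so mollification in the chart preserves Lipschitz
constants for it, and raises those for `fdist` at most by the factor `(1 + η) / (1 - η)`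
(`exists_local_approximation`).

The local approximations `k i` are glued by a partition of unity `ρ i`
(`exists_contMDiff_approximation`). Since the `ρ i` sum to one, their variation only multiplies the
errors `k i - f`. These are made small relative to the Lipschitz constant of `ρ i`, with summable
weights, so the gluing costs at most half of `lam`. -/

noncomputable section

open Set Filter Topology MeasureTheory Bundle

/-! ### Minkowski norms, and Finsler speed in charts -/

section Curves

variable {E : Type*} [NormedAddCommGroup E] [NormedSpace ℝ E]
  {M : Type*} [TopologicalSpace M] [ChartedSpace E M] [IsManifold 𝓘(ℝ, E) ∞ M]

namespace IsMinkowskiNorm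

variable {N : E → ℝ}

theorem map_zero (hN : IsMinkowskiNorm N) : N 0 = 0 := (hN.eq_zero_iff 0).2 rfl

theorem pos (hN : IsMinkowskiNorm N) {v : E} (hv : v ≠ 0) : 0 < N v :=
  lt_of_le_of_ne (hN.nonneg v) fun h => hv ((hN.eq_zero_iff v).1 h.symm)

/-- A Minkowski norm is comparable with the ambient norm. -/
theorem exists_bounds [FiniteDimensional ℝ E] (hN : IsMinkowskiNorm N) :
    ∃ a b : ℝ, 0 < a ∧ 0 < b ∧ ∀ v, a * ‖v‖ ≤ N v ∧ N v ≤ b * ‖v‖ := by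
  rcases subsingleton_or_nontrivial E with hE | hE
  · refine ⟨1, 1, one_pos, one_pos, fun v => ?_⟩
    rw [Subsingleton.elim v 0]
    simp [hN.map_zero]
  have hS : IsCompact (Metric.sphere (0 : E) 1) := isCompact_sphere 0 1
  have hne : (Metric.sphere (0 : E) 1).Nonempty := NormedSpace.sphere_nonempty.2 zero_le_one
  obtain ⟨v₀, hv₀, hmin⟩ := hS.exists_isMinOn hne hN.continuous.continuousOn
  obtain ⟨v₁, hv₁, hmax⟩ := hS.exists_isMaxOn hne hN.continuous.continuousOn
  have hv₀' : v₀ ≠ 0 := by rintro rfl; simp at hv₀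
  have hv₁' : v₁ ≠ 0 := by rintro rfl; simp at hv₁
  refine ⟨N v₀, N v₁, hN.pos hv₀', hN.pos hv₁', fun v => ?_⟩
  rcases eq_or_ne v 0 with rfl | hv
  · simp [hN.map_zero]
  have hn : 0 < ‖v‖ := norm_pos_iff.2 hv
  have hmem : ‖v‖⁻¹ • v ∈ Metric.sphere (0 : E) 1 := by
    simp [norm_smul, hn.ne']
  have heq : N v = N (‖v‖⁻¹ • v) * ‖v‖ := by
    rw [hN.smul _ _ (inv_nonneg.2 hn.le)]
    field_simp
  rw [heq]
  exact ⟨mul_le_mul_of_nonneg_right (hmin hmem) hn.le,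
    mul_le_mul_of_nonneg_right (hmax hmem) hn.le⟩

/-- A Minkowski norm has a supporting linear functional at each vector. -/
theorem exists_support [FiniteDimensional ℝ E] (hN : IsMinkowskiNorm N) (v : E) :
    ∃ ℓ : E →L[ℝ] ℝ, ℓ v = N v ∧ ∀ w, ℓ w ≤ N w := by
  rcases eq_or_ne v 0 with rfl | hv
  · exact ⟨0, by simp [hN.map_zero], fun w => by simpa using hN.nonneg w⟩
  -- Hahn–Banach from the line through `v`; on its negative half the functional is nonpositive, so
  -- no symmetry of `N` is needed.
  obtain ⟨g, hg, hgN⟩ := exists_extension_of_le_sublinear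
    (LinearPMap.mkSpanSingleton v (N v) hv) N (fun c hc x => hN.smul c x hc.le) hN.triangle (by
      rintro ⟨x, hx⟩
      obtain ⟨c, rfl⟩ := Submodule.mem_span_singleton.1 hx
      rw [show LinearPMap.mkSpanSingleton v (N v) hv ⟨c • v, hx⟩ = c • N v from
        LinearPMap.mkSpanSingleton'_apply _ _ _ c hx]
      rcases le_total 0 c with hc | hc
      · simp [hN.smul c v hc]
      · exact (mul_nonpos_of_nonpos_of_nonneg hc (hN.nonneg v)).trans (hN.nonneg _))
  refine ⟨LinearMap.toContinuousLinearMap g, ?_, hgN⟩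
  exact (hg ⟨v, Submodule.mem_span_singleton_self v⟩).trans
    (LinearPMap.mkSpanSingleton_apply ..)

end IsMinkowskiNorm

namespace FinslerStructure

variable (F : FinslerStructure E M)

/-- The Finsler norm at `x` of the tangent vector with coordinates `w` in the chart at `p`. -/
def chartNorm (p x : M) (w : E) : ℝ :=
  F.toFun x ((trivializationAt E (TangentSpace 𝓘(ℝ, E)) p).symm x w)

theorem continuousOn_chartNorm (p : M) :
    ContinuousOn (fun z : M × E => F.chartNorm p z.1 z.2) ((chartAt E p).source ×ˢ univ) := by
  have h := (trivializationAt E (TangentSpace 𝓘(ℝ, E)) p).continuousOn_symm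
  exact F.continuous.comp_continuousOn h

theorem chartNorm_self (p : M) (w : E) : F.chartNorm p p w = F.toFun p w := by
  have hp : p ∈ (chartAt E p).source := mem_chart_source E p
  rw [chartNorm, ← Trivialization.symmL_apply (R := ℝ) _ (by simp),
    TangentBundle.symmL_trivializationAt_eq_core hp]
  congr 1
  exact tangentCoordChange_self (I := 𝓘(ℝ, E)) (mem_extChartAt_source p)

theorem chartNorm_smul {p x : M} (hx : x ∈ (chartAt E p).source) {c : ℝ} (hc : 0 ≤ c) (w : E) :
    F.chartNorm p x (c • w) = c * F.chartNorm p x w := by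
  have hx' : x ∈ (trivializationAt E (TangentSpace 𝓘(ℝ, E)) p).baseSet := by simpa using hx
  simp only [chartNorm, ← Trivialization.symmL_apply (R := ℝ) _ hx', _root_.map_smul]
  exact (F.minkowski x).smul c _ hc

/-- The speed of a curve is the chart norm of its coordinate velocity. -/
theorem hasDerivAt_chart_comp {p : M} {γ : ℝ → M} {t : ℝ}
    (hγ : MDifferentiableAt 𝓘(ℝ, ℝ) 𝓘(ℝ, E) γ t) (ht : γ t ∈ (chartAt E p).source) :
    ∃ c : E, HasDerivAt (fun s => extChartAt 𝓘(ℝ, E) p (γ s)) c t ∧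
      F.speed γ t = F.chartNorm p (γ t) c := by
  have hx' : γ t ∈ (trivializationAt E (TangentSpace 𝓘(ℝ, E)) p).baseSet := by simpa using ht
  refine ⟨(trivializationAt E (TangentSpace 𝓘(ℝ, E)) p).continuousLinearMapAt ℝ (γ t)
    (mfderiv 𝓘(ℝ, ℝ) 𝓘(ℝ, E) γ t (1 : ℝ)), ?_, ?_⟩
  · rw [TangentBundle.continuousLinearMapAt_trivializationAt ht]
    have h1 := (mdifferentiableAt_extChartAt (I := 𝓘(ℝ, E)) ht).hasMFDerivAt
    have h2 : HasFDerivAt (fun s => extChartAt 𝓘(ℝ, E) p (γ s))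
        ((show E →L[ℝ] E from mfderiv 𝓘(ℝ, E) 𝓘(ℝ, E) (extChartAt 𝓘(ℝ, E) p) (γ t)).comp
          (show ℝ →L[ℝ] E from mfderiv 𝓘(ℝ, ℝ) 𝓘(ℝ, E) γ t)) t :=
      (h1.comp t hγ.hasMFDerivAt).hasFDerivAt
    exact h2.hasDerivAt
  · rw [chartNorm, ← Trivialization.symmL_apply (R := ℝ) _ hx',
      Trivialization.symmL_continuousLinearMapAt _ hx']
    rfl

theorem speed_nonneg (γ : ℝ → M) (t : ℝ) : 0 ≤ F.speed γ t := (F.minkowski _).nonneg _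

/-- `speed` uses the two-sided derivative, which may be the default `0` at the end points. The
derivative within `Icc a b` gives a continuous integrand that agrees with it on the interior, hence
almost everywhere. -/
theorem intervalIntegrable_speed {γ : ℝ → M} {a b : ℝ} (hab : a ≤ b)
    (hγ : ContMDiffOn 𝓘(ℝ, ℝ) 𝓘(ℝ, E) 1 γ (Icc a b)) :
    IntervalIntegrable (F.speed γ) volume a b := by
  rcases hab.eq_or_lt with rfl | h
  · simp
  have hu : UniqueMDiffOn 𝓘(ℝ, ℝ) (Icc a b) := (uniqueDiffOn_Icc h).uniqueMDiffOn
  have h1 := hγ.continuousOn_tangentMapWithin le_rfl hu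
  have hs : Continuous fun t : ℝ => (tangentBundleModelSpaceHomeomorph 𝓘(ℝ, ℝ)).symm (t, (1 : ℝ)) :=
    (Homeomorph.continuous _).comp (by fun_prop)
  have h2 : ContinuousOn (fun t => F.toFun (γ t) (mfderivWithin 𝓘(ℝ, ℝ) 𝓘(ℝ, E) γ (Icc a b) t
      (1 : ℝ))) (Icc a b) :=
    F.continuous.comp_continuousOn (h1.comp hs.continuousOn fun t ht => ht)
  rw [← uIcc_of_le hab] at h2
  refine h2.intervalIntegrable.congr_ae ?_
  rw [uIoc_of_le hab, ← restrict_Ioo_eq_restrict_Ioc]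
  filter_upwards [self_mem_ae_restrict measurableSet_Ioo] with t ht
  rw [uIcc_of_le hab, mfderivWithin_of_mem_nhds (Icc_mem_nhds ht.1 ht.2)]
  rfl

/-- Near `p` the chart norm is close to the norm at `p`. -/
theorem eventually_chartNorm [FiniteDimensional ℝ E] (p : M) {η : ℝ} (hη : 0 < η) :
    ∀ᶠ x in 𝓝 p, x ∈ (chartAt E p).source ∧ ∀ w : E,
      (1 - η) * F.toFun p w ≤ F.chartNorm p x w ∧
        F.chartNorm p x w ≤ (1 + η) * F.toFun p w := by
  have hN : IsMinkowskiNorm (V := E) (F.toFun p) := F.minkowski p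
  have hs : (chartAt E p).source ∈ 𝓝 p := chart_source_mem_nhds E p
  have key : ∀ᶠ x in 𝓝 p, ∀ w ∈ Metric.sphere (0 : E) 1,
      (1 - η) * F.toFun p w < F.chartNorm p x w ∧
        F.chartNorm p x w < (1 + η) * F.toFun p w := by
    -- The strict inequalities hold at `(p, w)` and are open conditions; compactness of the sphere
    -- makes them uniform in `w`, and homogeneity extends them to all vectors.
    refine (isCompact_sphere (0 : E) 1).eventually_forall_of_forall_eventually
      (P := fun x w => (1 - η) * F.toFun p w < F.chartNorm p x w ∧
        F.chartNorm p x w < (1 + η) * F.toFun p w) fun w hw => ?_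
    have hw0 : w ≠ 0 := by rintro rfl; simp at hw
    have hpos := hN.pos hw0
    have hc : ContinuousAt (fun z : M × E => F.chartNorm p z.1 z.2) (p, w) :=
      (F.continuousOn_chartNorm p).continuousAt
        (prod_mem_nhds hs univ_mem)
    have hNc : ContinuousAt (fun z : M × E => (F.toFun p : E → ℝ) z.2) (p, w) :=
      (hN.continuous.comp continuous_snd).continuousAt
    have hself := F.chartNorm_self p w
    refine ((continuousAt_const.mul hNc).eventually_lt hc ?_).and
      (hc.eventually_lt (continuousAt_const.mul hNc) ?_)
    · change (1 - η) * F.toFun p w < F.chartNorm p p w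
      rw [hself]; nlinarith
    · change F.chartNorm p p w < (1 + η) * F.toFun p w
      rw [hself]; nlinarith
  filter_upwards [key, hs] with x hx hxs
  refine ⟨hxs, fun w => ?_⟩
  rcases eq_or_ne w 0 with rfl | hw
  · have h0 := F.chartNorm_smul hxs le_rfl (0 : E)
    rw [zero_smul, zero_mul] at h0
    have h1 : F.toFun p (0 : E) = 0 := hN.map_zero
    rw [h0]
    exact ⟨by simp [h1], by simp [h1]⟩
  have hn : 0 < ‖w‖ := norm_pos_iff.2 hw
  have hmem : ‖w‖⁻¹ • w ∈ Metric.sphere (0 : E) 1 := by simp [norm_smul, hn.ne']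
  obtain ⟨h1, h2⟩ := hx _ hmem
  have e : F.toFun p (‖w‖⁻¹ • w) = ‖w‖⁻¹ * F.toFun p w := hN.smul _ _ (inv_nonneg.2 hn.le)
  rw [F.chartNorm_smul hxs (inv_nonneg.2 hn.le), e, ← mul_left_comm] at h1 h2
  exact ⟨(lt_of_mul_lt_mul_left h1 (inv_nonneg.2 hn.le)).le,
    (lt_of_mul_lt_mul_left h2 (inv_nonneg.2 hn.le)).le⟩

end FinslerStructure

end Curves

/-! ### Piecewise `C¹` curves and bounds on the Finsler distance -/

section Distance

variable {E : Type*} [NormedAddCommGroup E] [NormedSpace ℝ E]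
  {M : Type*} [TopologicalSpace M] [ChartedSpace E M]

namespace IsPiecewiseC1

theorem continuousOn {γ : ℝ → M} (hγ : IsPiecewiseC1 E γ) : ContinuousOn γ (Icc 0 1) := by
  obtain ⟨n, t, ht, h0, h1, hC⟩ := hγ
  have key : ∀ i ≤ n, ContinuousOn γ (Icc 0 (t i)) := by
    intro i
    induction i with
    | zero => intro _; rw [h0, Icc_self]; exact continuousOn_singleton _ _
    | succ i ih =>
      intro hi
      rw [← Icc_union_Icc_eq_Icc (h0 ▸ ht (Nat.zero_le i)) (ht i.le_succ)]
      exact (ih (by omega)).union_of_isClosed (hC i hi).continuousOn isClosed_Icc isClosed_Icc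
  rw [← h1]
  exact key n le_rfl

theorem of_contMDiffOn {γ : ℝ → M} (hγ : ContMDiffOn 𝓘(ℝ, ℝ) 𝓘(ℝ, E) 1 γ (Icc 0 1)) :
    IsPiecewiseC1 E γ := by
  refine ⟨1, fun i => if i = 0 then 0 else 1, fun i j hij => ?_, by simp, by simp, ?_⟩
  · rcases Nat.eq_zero_or_pos i with rfl | hi
    · simp only [if_true]; split_ifs <;> norm_num
    · simp [hi.ne', (hi.trans_le hij).ne']
  · intro i hi
    obtain rfl : i = 0 := by omega
    simpa using hγ

/-- Concatenation of piecewise `C¹` curves. -/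
theorem concat {γ₁ γ₂ : ℝ → M} (h₁ : IsPiecewiseC1 E γ₁) (h₂ : IsPiecewiseC1 E γ₂)
    (h : γ₁ 1 = γ₂ 0) :
    IsPiecewiseC1 E fun s => if s ≤ 1 / 2 then γ₁ (2 * s) else γ₂ (2 * s - 1) := by
  obtain ⟨n, t, ht, ht0, htn, hC⟩ := h₁
  obtain ⟨m, r, hr, hr0, hrm, hD⟩ := h₂
  have hrnn : ∀ i, 0 ≤ r i := fun i => hr0 ▸ hr (Nat.zero_le i)
  refine ⟨n + m, fun i => if i ≤ n then t i / 2 else (1 + r (i - n)) / 2, ?_, by simp [ht0], ?_, ?_⟩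
  · intro i j hij
    dsimp only
    split_ifs with hi hj hj
    · linarith [ht hij]
    · linarith [ht hi, hrnn (j - n)]
    · omega
    · linarith [hr (show i - n ≤ j - n by omega)]
  · rcases Nat.eq_zero_or_pos m with rfl | hm
    · linarith
    · simp [hm.ne', hrm]
  · intro i hi
    have smooth1 : ContMDiff 𝓘(ℝ, ℝ) 𝓘(ℝ, ℝ) 1 fun s : ℝ => 2 * s :=
      ContDiff.contMDiff (by fun_prop)
    have smooth2 : ContMDiff 𝓘(ℝ, ℝ) 𝓘(ℝ, ℝ) 1 fun s : ℝ => 2 * s - 1 :=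
      ContDiff.contMDiff (by fun_prop)
    dsimp only
    by_cases hin : i < n
    · rw [if_pos hin.le, if_pos (show i + 1 ≤ n from hin)]
      have hle : t (i + 1) ≤ 1 := htn ▸ ht hin
      refine ((hC i hin).comp smooth1.contMDiffOn fun s hs => ?_).congr fun s hs => ?_
      · exact ⟨by linarith [hs.1], by linarith [hs.2]⟩
      · have : s ≤ 1 / 2 := by linarith [hs.2]
        simp only [this, if_true, Function.comp]
    -- At `i = n` the first branch applies, but `t n = 1` and `r 0 = 0` make both branches `1 / 2`.
    · have hlow : (if i ≤ n then t i / 2 else (1 + r (i - n)) / 2) = (1 + r (i - n)) / 2 := by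
        split_ifs with hin'
        · obtain rfl : i = n := by omega
          simp [htn, hr0]
        · rfl
      rw [hlow, if_neg (show ¬ i + 1 ≤ n by omega), show i + 1 - n = (i - n) + 1 by omega]
      refine ((hD (i - n) (by omega)).comp smooth2.contMDiffOn fun s hs => ?_).congr fun s hs => ?_
      · exact ⟨by linarith [hs.1], by linarith [hs.2]⟩
      · have hs' : 1 / 2 ≤ s := by linarith [hs.1, hrnn (i - n)]
        rcases hs'.eq_or_lt with rfl | hlt
        · simp [h]
        · simp only [not_le.2 hlt, if_false, Function.comp]

end IsPiecewiseC1

/-- A curve which is a straight segment in a chart. -/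
theorem contMDiffOn_chart_segment [IsManifold 𝓘(ℝ, E) ∞ M] (p : M) (u v : E) :
    ContMDiffOn 𝓘(ℝ, ℝ) 𝓘(ℝ, E) 1
      (fun s : ℝ => (extChartAt 𝓘(ℝ, E) p).symm (u + s • (v - u)))
      ((fun s : ℝ => u + s • (v - u)) ⁻¹' (extChartAt 𝓘(ℝ, E) p).target) := by
  have : IsManifold 𝓘(ℝ, E) 1 M := .of_le (n := ∞) (by norm_num)
  have h1 := contMDiffOn_extChartAt_symm (I := 𝓘(ℝ, E)) (n := 1) p
  have h2 : ContMDiff 𝓘(ℝ, ℝ) 𝓘(ℝ, E) 1 fun s : ℝ => u + s • (v - u) :=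
    ContDiff.contMDiff (by fun_prop)
  exact h1.comp h2.contMDiffOn subset_rfl

theorem mem_ball_segment {c u v : E} {R s : ℝ} (hu : u ∈ Metric.ball c R)
    (hv : v ∈ Metric.ball c R) (hs : s ∈ Icc (0 : ℝ) 1) : u + s • (v - u) ∈ Metric.ball c R :=
  (convex_ball c R).add_smul_sub_mem hu hv hs

theorem isPiecewiseC1_chart_segment [IsManifold 𝓘(ℝ, E) ∞ M] {p : M} {c u v : E} {R : ℝ}
    (hR : Metric.ball c R ⊆ (extChartAt 𝓘(ℝ, E) p).target) (hu : u ∈ Metric.ball c R)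
    (hv : v ∈ Metric.ball c R) :
    IsPiecewiseC1 E fun s : ℝ => (extChartAt 𝓘(ℝ, E) p).symm (u + s • (v - u)) :=
  .of_contMDiffOn <| (contMDiffOn_chart_segment p u v).mono fun _ hs =>
    hR (mem_ball_segment hu hv hs)

theorem exists_ball_subset_target (p : M) :
    ∃ R > 0, Metric.ball (extChartAt 𝓘(ℝ, E) p p) R ⊆ (extChartAt 𝓘(ℝ, E) p).target :=
  Metric.mem_nhds_iff.1 (extChartAt_target_mem_nhds p)

/-- Any two points of a connected manifold are joined by a piecewise `C¹` curve. -/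
theorem exists_isPiecewiseC1 [IsManifold 𝓘(ℝ, E) ∞ M] [ConnectedSpace M] (x y : M) :
    ∃ γ : ℝ → M, IsPiecewiseC1 E γ ∧ γ 0 = x ∧ γ 1 = y := by
  -- Being joined is transitive by concatenation, and holds in both directions between a point and
  -- its neighbours by chart segments.
  refine PreconnectedSpace.induction₂' (fun x y => ∃ γ : ℝ → M, IsPiecewiseC1 E γ ∧ γ 0 = x ∧ γ 1 = y)
    (fun p => ?_) ?_ x y
  · obtain ⟨R, hR, hsub⟩ := exists_ball_subset_target (E := E) p
    have hc := (continuousAt_extChartAt (I := 𝓘(ℝ, E)) p).preimage_mem_nhds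
      (Metric.ball_mem_nhds _ hR)
    have hp := Metric.mem_ball_self (x := extChartAt 𝓘(ℝ, E) p p) hR
    filter_upwards [hc, extChartAt_source_mem_nhds (I := 𝓘(ℝ, E)) p] with y hy hys
    have e1 := (extChartAt 𝓘(ℝ, E) p).left_inv (mem_extChartAt_source p)
    have e2 := (extChartAt 𝓘(ℝ, E) p).left_inv hys
    exact ⟨⟨_, isPiecewiseC1_chart_segment hsub hp hy, by simp, by simpa using e2⟩,
      ⟨_, isPiecewiseC1_chart_segment hsub hy hp, by simpa using e2, by simp⟩⟩
  · refine ⟨?_⟩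
    rintro a b c ⟨γ₁, h₁, rfl, rfl⟩ ⟨γ₂, h₂, h, rfl⟩
    exact ⟨_, h₁.concat h₂ h.symm, by norm_num, by norm_num⟩

namespace FinslerStructure

variable [IsManifold 𝓘(ℝ, E) ∞ M] (F : FinslerStructure E M)

theorem _root_.IsPiecewiseC1.intervalIntegrable_speed {γ : ℝ → M} (hγ : IsPiecewiseC1 E γ) :
    IntervalIntegrable (F.speed γ) volume 0 1 := by
  obtain ⟨n, t, ht, h0, h1, hC⟩ := hγ
  rw [← h0, ← h1]
  exact IntervalIntegrable.trans_iterate fun k hk => F.intervalIntegrable_speed (ht k.le_succ) (hC k hk)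

theorem length_nonneg (γ : ℝ → M) {a b : ℝ} (hab : a ≤ b) : 0 ≤ F.length γ a b :=
  intervalIntegral.integral_nonneg hab fun t _ => F.speed_nonneg γ t

theorem fdist_nonneg (x y : M) : 0 ≤ F.fdist x y :=
  Real.sInf_nonneg <| by
    rintro _ ⟨γ, -, -, -, rfl⟩
    exact F.length_nonneg γ zero_le_one

theorem fdist_le_length {γ : ℝ → M} (hγ : IsPiecewiseC1 E γ) :
    F.fdist (γ 0) (γ 1) ≤ F.length γ 0 1 :=
  csInf_le ⟨0, by rintro _ ⟨γ, -, -, -, rfl⟩; exact F.length_nonneg γ zero_le_one⟩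
    ⟨γ, hγ, rfl, rfl, rfl⟩

/-- Connectedness makes the set of lengths nonempty; otherwise its real infimum would be the default
`0`. -/
theorem le_fdist [ConnectedSpace M] {x y : M} {c : ℝ}
    (h : ∀ γ : ℝ → M, IsPiecewiseC1 E γ → γ 0 = x → γ 1 = y → c ≤ F.length γ 0 1) :
    c ≤ F.fdist x y := by
  obtain ⟨γ, hγ, hx, hy⟩ := exists_isPiecewiseC1 (E := E) x y
  refine le_csInf ⟨_, γ, hγ, hx, hy, rfl⟩ ?_
  rintro _ ⟨γ, hγ, hx, hy, rfl⟩
  exact h γ hγ hx hy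

/-- Distances are at most the lengths of segments in a chart. -/
theorem fdist_chart_le {p : M} {c u v : E} {R B : ℝ}
    (hR : Metric.ball c R ⊆ (extChartAt 𝓘(ℝ, E) p).target) (hu : u ∈ Metric.ball c R)
    (hv : v ∈ Metric.ball c R)
    (hB : ∀ z ∈ Metric.ball c R,
      F.chartNorm p ((extChartAt 𝓘(ℝ, E) p).symm z) (v - u) ≤ B) :
    F.fdist ((extChartAt 𝓘(ℝ, E) p).symm u) ((extChartAt 𝓘(ℝ, E) p).symm v) ≤ B := by
  set γ : ℝ → M := fun s => (extChartAt 𝓘(ℝ, E) p).symm (u + s • (v - u)) with hγdef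
  have h := F.fdist_le_length (isPiecewiseC1_chart_segment hR hu hv)
  simp only [zero_smul, add_zero, one_smul, add_sub_cancel] at h
  refine h.trans ((le_abs_self _).trans ?_)
  have hspeed : ∀ s ∈ Icc (0 : ℝ) 1, F.speed γ s ≤ B := by
    intro s hs
    have hmem := mem_ball_segment hu hv hs
    have hopen : IsOpen ((fun s : ℝ => u + s • (v - u)) ⁻¹' (extChartAt 𝓘(ℝ, E) p).target) :=
      (isOpen_extChartAt_target p).preimage (by fun_prop)
    have hd : MDifferentiableAt 𝓘(ℝ, ℝ) 𝓘(ℝ, E) γ s :=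
      ((contMDiffOn_chart_segment p u v).contMDiffAt
        (hopen.mem_nhds (hR hmem))).mdifferentiableAt one_ne_zero
    have hsrc : γ s ∈ (chartAt E p).source := by
      rw [← extChartAt_source 𝓘(ℝ, E)]
      exact (extChartAt 𝓘(ℝ, E) p).map_target (hR hmem)
    obtain ⟨w, hw, hsp⟩ := F.hasDerivAt_chart_comp hd hsrc
    have hw' : HasDerivAt (fun s : ℝ => u + s • (v - u)) ((1 : ℝ) • (v - u)) s :=
      ((hasDerivAt_id s).smul_const (v - u)).const_add u
    have heq : (fun s => extChartAt 𝓘(ℝ, E) p (γ s)) =ᶠ[𝓝 s] fun s : ℝ => u + s • (v - u) := by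
      filter_upwards [hopen.mem_nhds (hR hmem)] with r hr
      exact (extChartAt 𝓘(ℝ, E) p).right_inv hr
    have : w = v - u := by
      rw [← one_smul ℝ (v - u)]
      exact (hw.congr_of_eventuallyEq heq.symm).unique hw'
    rw [hsp, this]
    exact hB _ hmem
  have := intervalIntegral.norm_integral_le_of_norm_le_const (a := (0 : ℝ)) (b := 1)
    (f := F.speed γ) (C := B) fun s hs => by
      rw [uIoc_of_le zero_le_one] at hs
      rw [Real.norm_eq_abs, abs_of_nonneg (F.speed_nonneg γ s)]
      exact hspeed s ⟨hs.1.le, hs.2⟩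
  rwa [sub_zero, abs_one, mul_one] at this

section LowerBound

variable {γ : ℝ → M} {p : M} {A : Set M} {C : ℝ} {ℓ : E →L[ℝ] ℝ}

/-- Calibration: the derivative of `ℓ` along the curve in the chart is at most `C` times the speed,
and this integrates. -/
theorem support_sub_le_integral_of_contMDiffOn {a b : ℝ} (hab : a ≤ b)
    (hγ : ContMDiffOn 𝓘(ℝ, ℝ) 𝓘(ℝ, E) 1 γ (Icc a b)) (hA : A ⊆ (chartAt E p).source)
    (hℓ : ∀ x ∈ A, ∀ w, ℓ w ≤ C * F.chartNorm p x w) (hmaps : MapsTo γ (Icc a b) A) :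
    ℓ (extChartAt 𝓘(ℝ, E) p (γ b)) - ℓ (extChartAt 𝓘(ℝ, E) p (γ a)) ≤
      C * F.length γ a b := by
  have hcont : ContinuousOn (fun s => ℓ (extChartAt 𝓘(ℝ, E) p (γ s))) (Icc a b) :=
    ℓ.continuous.comp_continuousOn ((continuousOn_extChartAt p).comp hγ.continuousOn
      fun s hs => by rw [extChartAt_source]; exact hA (hmaps hs))
  have hd : ∀ s ∈ Ioo a b, ∃ c : E, HasDerivAt (fun s => extChartAt 𝓘(ℝ, E) p (γ s)) c s ∧
      F.speed γ s = F.chartNorm p (γ s) c := fun s hs =>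
    F.hasDerivAt_chart_comp
      ((hγ.contMDiffAt (Icc_mem_nhds hs.1 hs.2)).mdifferentiableAt one_ne_zero)
      (hA (hmaps (Ioo_subset_Icc_self hs)))
  choose! c hc hsp using hd
  rw [length, ← intervalIntegral.integral_const_mul]
  refine intervalIntegral.sub_le_integral_of_hasDeriv_right_of_le
    (g := fun s => ℓ (extChartAt 𝓘(ℝ, E) p (γ s))) (g' := fun s => ℓ (c s)) hab hcont
    (fun s hs => ?_) ?_ fun s hs => ?_
  · exact (ℓ.hasFDerivAt.comp_hasDerivAt s (hc s hs)).hasDerivWithinAt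
  · rw [← intervalIntegrable_iff_integrableOn_Icc_of_le hab]
    exact (F.intervalIntegrable_speed hab hγ).const_mul C
  · rw [hsp s hs]
    exact hℓ _ (hmaps (Ioo_subset_Icc_self hs)) _

theorem support_sub_le_integral (hγ : IsPiecewiseC1 E γ) (hA : A ⊆ (chartAt E p).source)
    (hℓ : ∀ x ∈ A, ∀ w, ℓ w ≤ C * F.chartNorm p x w) {τ : ℝ} (hτ : τ ∈ Icc (0 : ℝ) 1)
    (hmaps : MapsTo γ (Icc 0 τ) A) :
    ℓ (extChartAt 𝓘(ℝ, E) p (γ τ)) - ℓ (extChartAt 𝓘(ℝ, E) p (γ 0)) ≤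
      C * F.length γ 0 τ := by
  have hint := hγ.intervalIntegrable_speed F
  obtain ⟨n, t, ht, h0, h1, hC⟩ := hγ
  have hnn : ∀ i, 0 ≤ t i := fun i => h0 ▸ ht (Nat.zero_le i)
  have hsub : ∀ {a b : ℝ}, 0 ≤ a → a ≤ b → b ≤ 1 → IntervalIntegrable (F.speed γ) volume a b :=
    fun ha hab hb => hint.mono_set (by
      rw [uIcc_of_le hab, uIcc_of_le zero_le_one]; exact Icc_subset_Icc ha hb)
  -- The subdivision is truncated at `τ`; once `t i` passes `τ` the claim no longer changes.
  have key : ∀ i ≤ n, ℓ (extChartAt 𝓘(ℝ, E) p (γ (min (t i) τ))) -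
      ℓ (extChartAt 𝓘(ℝ, E) p (γ 0)) ≤ C * F.length γ 0 (min (t i) τ) := by
    intro i
    induction i with
    | zero => intro _; simp [h0, hτ.1, length]
    | succ i ih =>
      intro hi
      have ih' := ih (by omega)
      rcases le_total τ (t i) with h | h
      · rwa [min_eq_right (h.trans (ht i.le_succ)), ← min_eq_right h]
      · rw [min_eq_left h] at ih'
        have hle : t i ≤ min (t (i + 1)) τ := le_min (ht i.le_succ) h
        have hstep := F.support_sub_le_integral_of_contMDiffOn hle
          ((hC i hi).mono (Icc_subset_Icc_right (min_le_left _ _))) hA hℓ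
          (hmaps.mono_left (Icc_subset_Icc (hnn i) (min_le_right _ _)))
        have hadd : F.length γ 0 (t i) + F.length γ (t i) (min (t (i + 1)) τ) =
            F.length γ 0 (min (t (i + 1)) τ) :=
          intervalIntegral.integral_add_adjacent_intervals
            (hsub le_rfl (hnn i) (h.trans hτ.2))
            (hsub (hnn i) hle ((min_le_right _ _).trans hτ.2))
        rw [← hadd, mul_add]
        linarith
  have := key n le_rfl
  rwa [h1, min_eq_right hτ.2] at this

/-- A curve starting at `x` is at least as long, up to the factor `C`, as the chart displacement
of its end point, or as the radius of a ball around `x` in the chart which it leaves. -/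
theorem displacement_le_length [FiniteDimensional ℝ E] [T2Space M] {N : E → ℝ}
    (hN : IsMinkowskiNorm N) (hγ : IsPiecewiseC1 E γ) (h0 : γ 0 ∈ (chartAt E p).source)
    {ρ : ℝ} (hρ : 0 < ρ) (hC : 0 ≤ C)
    (hball : ∀ u, N (u - extChartAt 𝓘(ℝ, E) p (γ 0)) ≤ ρ → u ∈ (extChartAt 𝓘(ℝ, E) p).target)
    (hNF : ∀ z ∈ (chartAt E p).source,
      N (extChartAt 𝓘(ℝ, E) p z - extChartAt 𝓘(ℝ, E) p (γ 0)) ≤ ρ →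
      ∀ w, N w ≤ C * F.chartNorm p z w) :
    (γ 1 ∈ (chartAt E p).source ∧
      N (extChartAt 𝓘(ℝ, E) p (γ 1) - extChartAt 𝓘(ℝ, E) p (γ 0)) ≤ C * F.length γ 0 1) ∨
    ρ ≤ C * F.length γ 0 1 := by
  set φ := extChartAt 𝓘(ℝ, E) p with hφ
  set A : Set M := {z | z ∈ (chartAt E p).source ∧ N (φ z - φ (γ 0)) ≤ ρ} with hAdef
  have hA : A ⊆ (chartAt E p).source := fun z hz => hz.1
  have main : ∀ τ ∈ Icc (0 : ℝ) 1, MapsTo γ (Icc 0 τ) A →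
      N (φ (γ τ) - φ (γ 0)) ≤ C * F.length γ 0 τ := by
    intro τ hτ hmaps
    obtain ⟨ℓ, hℓ, hℓN⟩ := hN.exists_support (φ (γ τ) - φ (γ 0))
    rw [← hℓ, map_sub]
    exact F.support_sub_le_integral hγ hA
      (fun x hx w => (hℓN w).trans (hNF x hx.1 hx.2 w)) hτ hmaps
  set O : Set M := φ.source ∩ φ ⁻¹' {u | N (u - φ (γ 0)) < ρ} with hOdef
  have hO : IsOpen O := (continuousOn_extChartAt p).isOpen_inter_preimage
    (isOpen_extChartAt_source p)
    (isOpen_lt (hN.continuous.comp (by fun_prop)) continuous_const)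
  have hOA : O ⊆ A := fun z hz => ⟨by rw [← extChartAt_source 𝓘(ℝ, E)]; exact hz.1, le_of_lt hz.2⟩
  have hcont := hγ.continuousOn
  by_cases hall : ∀ t ∈ Icc (0 : ℝ) 1, γ t ∈ O
  · exact .inl ⟨(hOA (hall 1 (by simp))).1, main 1 (by simp) fun t ht => hOA (hall t ht)⟩
  right
  push Not at hall
  have hS : IsCompact (Icc (0 : ℝ) 1 ∩ γ ⁻¹' Oᶜ) :=
    isCompact_Icc.of_isClosed_subset
      (hcont.preimage_isClosed_of_isClosed isClosed_Icc hO.isClosed_compl) inter_subset_left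
  obtain ⟨t₁, ht₁, ht₁O⟩ := hall
  -- `τ` is the first time at which the curve is outside the open ball `O`.
  obtain ⟨τ, ⟨hτ, hτO⟩, hmin⟩ := hS.exists_isLeast ⟨t₁, ht₁, ht₁O⟩
  have hbefore : ∀ t ∈ Ico 0 τ, γ t ∈ O := by
    intro t ht
    by_contra hcon
    exact absurd (hmin ⟨⟨ht.1, ht.2.le.trans hτ.2⟩, hcon⟩) (not_le.2 ht.2)
  have h0O : γ 0 ∈ O := ⟨by rw [extChartAt_source]; exact h0, by simpa [hN.map_zero] using hρ⟩
  have hτpos : 0 < τ := lt_of_le_of_ne hτ.1 fun h => hτO (h ▸ h0O)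
  -- A priori `γ τ` could lie outside the chart. The image of the compact ball `K` is closed because
  -- `M` is Hausdorff, so the limit point `γ τ` stays in it.
  set K : Set E := {u | N (u - φ (γ 0)) ≤ ρ} with hK
  have hKc : IsCompact K := by
    obtain ⟨a, b, ha, -, hab⟩ := hN.exists_bounds
    refine (isCompact_closedBall (φ (γ 0)) (ρ / a)).of_isClosed_subset
      (isClosed_le (hN.continuous.comp (by fun_prop)) continuous_const) fun u hu => ?_
    rw [Metric.mem_closedBall, dist_eq_norm, le_div_iff₀ ha, mul_comm]
    exact (hab _).1.trans hu
  have hK' : IsClosed (φ.symm '' K) :=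
    (hKc.image_of_continuousOn ((continuousOn_extChartAt_symm p).mono hball)).isClosed
  have hclos : γ τ ∈ closure (φ.symm '' K) := by
    have hτcl : τ ∈ closure (Ico 0 τ) := by
      rw [closure_Ico hτpos.ne]; exact ⟨hτ.1, le_rfl⟩
    refine ((hcont τ hτ).mono (Ico_subset_Icc_self.trans (Icc_subset_Icc_right hτ.2))).mem_closure
      hτcl fun t ht => ?_
    have := hbefore t ht
    exact ⟨φ (γ t), mem_ofPred_eq ▸ le_of_lt this.2, φ.left_inv this.1⟩
  rw [hK'.closure_eq] at hclos
  obtain ⟨u, hu, huτ⟩ := hclos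
  have hsrc : γ τ ∈ φ.source := huτ ▸ φ.map_target (hball u hu)
  have hle : N (φ (γ τ) - φ (γ 0)) ≤ ρ := by
    rw [← huτ, φ.right_inv (hball u hu)]; exact hu
  have hge : ρ ≤ N (φ (γ τ) - φ (γ 0)) := not_lt.1 fun hlt => hτO ⟨hsrc, hlt⟩
  have hmaps : MapsTo γ (Icc 0 τ) A := by
    intro t ht
    rcases ht.2.eq_or_lt with rfl | hlt
    · exact ⟨by rw [← extChartAt_source 𝓘(ℝ, E)]; exact hsrc, hle⟩
    · exact hOA (hbefore t ⟨ht.1, hlt⟩)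
  refine hge.trans ((main τ hτ hmaps).trans (mul_le_mul_of_nonneg_left ?_ hC))
  exact intervalIntegral.integral_mono_interval le_rfl hτ.1 hτ.2
    (ae_of_all _ fun t => F.speed_nonneg γ t) (hγ.intervalIntegrable_speed F)

end LowerBound

end FinslerStructure

end Distance

/-! ### Mollification in the model space -/

section Mollification

variable {E : Type*} [NormedAddCommGroup E] [NormedSpace ℝ E] [FiniteDimensional ℝ E]

/-- Mollification at scale `r` of a continuous function on a finite-dimensional space. -/
theorem exists_mollification {h : E → ℝ} (hh : Continuous h) {r : ℝ} (hr : 0 < r) :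
    ∃ k : E → ℝ, ContDiff ℝ 1 k ∧
      (∀ u c A, (∀ w ∈ Metric.ball (0 : E) r, |h (u - w) - c| ≤ A) → |k u - c| ≤ A) ∧
      ∀ u v A, (∀ w ∈ Metric.ball (0 : E) r, |h (u - w) - h (v - w)| ≤ A) →
        |k u - k v| ≤ A := by
  let _ : MeasurableSpace E := borel E
  have : BorelSpace E := ⟨rfl⟩
  let μ : Measure E := Measure.addHaar
  let φ : ContDiffBump (0 : E) := ⟨r / 2, r, by linarith, by linarith⟩
  have hsupp : HasCompactSupport (φ.normed μ) := φ.hasCompactSupport_normed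
  have hint : ∀ q : E → ℝ, Continuous q → Integrable (fun w => φ.normed μ w * q w) μ := fun q hq =>
    (φ.continuous_normed.mul hq).integrable_of_hasCompactSupport hsupp.mul_right
  -- Averages against a probability density supported in the ball inherit bounds valid there; both
  -- estimates for `k` are instances.
  have hbound : ∀ (q : E → ℝ) (A : ℝ), (∀ w ∈ Metric.ball (0 : E) r, |q w| ≤ A) →
      |∫ w, φ.normed μ w * q w ∂μ| ≤ A := by
    intro q A hq
    have h1 : ∫ w, φ.normed μ w * A ∂μ = A := by
      rw [integral_mul_const, φ.integral_normed, one_mul]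
    rw [← Real.norm_eq_abs, ← h1]
    refine norm_integral_le_of_norm_le (hint _ continuous_const) (ae_of_all _ fun w => ?_)
    rw [norm_mul, Real.norm_of_nonneg (φ.nonneg_normed w), Real.norm_eq_abs]
    by_cases hw : w ∈ Metric.ball (0 : E) r
    · exact mul_le_mul_of_nonneg_left (hq w hw) (φ.nonneg_normed w)
    · have : φ.normed μ w = 0 := by
        rw [← Function.notMem_support, φ.support_normed_eq]; exact hw
      simp [this]
  refine ⟨fun u => ∫ w, φ.normed μ w * h (u - w) ∂μ, ?_, fun u c A hA => ?_, fun u v A hA => ?_⟩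
  · exact hsupp.contDiff_convolution_left (n := 1) (ContinuousLinearMap.lsmul ℝ ℝ)
      φ.contDiff_normed hh.locallyIntegrable
  · have h1 : ∫ w, φ.normed μ w * c ∂μ = c := by
      rw [integral_mul_const, φ.integral_normed, one_mul]
    have h2 := hbound _ A hA
    simp only [mul_sub] at h2
    rwa [integral_sub (hint (fun w => h (u - w)) (by fun_prop)) (hint _ continuous_const), h1] at h2
  · have h2 := hbound _ A hA
    simp only [mul_sub] at h2
    rwa [integral_sub (hint (fun w => h (u - w)) (by fun_prop))
      (hint (fun w => h (v - w)) (by fun_prop))] at h2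

end Mollification

/-! ### Comparison with the norm at a point, and local approximation -/

section Local

variable {E : Type*} [NormedAddCommGroup E] [NormedSpace ℝ E] [FiniteDimensional ℝ E]
  {M : Type*} [TopologicalSpace M] [ChartedSpace E M] [IsManifold 𝓘(ℝ, E) ∞ M]

namespace FinslerStructure

variable (F : FinslerStructure E M)

theorem exists_chart_ball (p : M) {η : ℝ} (hη : 0 < η) {U : Set M} (hU : U ∈ 𝓝 p) :
    ∃ R > 0, Metric.ball (extChartAt 𝓘(ℝ, E) p p) R ⊆ (extChartAt 𝓘(ℝ, E) p).target ∧
      ∀ u ∈ Metric.ball (extChartAt 𝓘(ℝ, E) p p) R, (extChartAt 𝓘(ℝ, E) p).symm u ∈ U ∧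
        ∀ w : E, (1 - η) * F.toFun p w ≤ F.chartNorm p ((extChartAt 𝓘(ℝ, E) p).symm u) w ∧
          F.chartNorm p ((extChartAt 𝓘(ℝ, E) p).symm u) w ≤ (1 + η) * F.toFun p w := by
  have h1 : ∀ᶠ x in 𝓝 p, x ∈ U ∧ ∀ w : E, (1 - η) * F.toFun p w ≤ F.chartNorm p x w ∧
      F.chartNorm p x w ≤ (1 + η) * F.toFun p w :=
    (eventually_mem_set.2 hU).and ((F.eventually_chartNorm p hη).mono fun x hx => hx.2)
  have hc := continuousAt_extChartAt_symm (I := 𝓘(ℝ, E)) p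
  rw [ContinuousAt, extChartAt_to_inv] at hc
  obtain ⟨R, hR, hsub⟩ := Metric.mem_nhds_iff.1
    (inter_mem (extChartAt_target_mem_nhds (I := 𝓘(ℝ, E)) p) (hc.eventually h1))
  exact ⟨R, hR, fun u hu => (hsub hu).1, fun u hu => (hsub hu).2⟩

variable [T2Space M] [ConnectedSpace M]

/-- In a small chart ball around `p`, the Finsler distance is close to the one given by the
Minkowski norm at `p`. -/
theorem exists_fdist_bounds (p : M) {η : ℝ} (hη : 0 < η) (hη1 : η < 1) :
    ∃ R > 0, Metric.ball (extChartAt 𝓘(ℝ, E) p p) R ⊆ (extChartAt 𝓘(ℝ, E) p).target ∧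
      ∀ u ∈ Metric.ball (extChartAt 𝓘(ℝ, E) p p) R,
      ∀ v ∈ Metric.ball (extChartAt 𝓘(ℝ, E) p p) R,
        (1 - η) * F.toFun p (v - u : E) ≤
          F.fdist ((extChartAt 𝓘(ℝ, E) p).symm u) ((extChartAt 𝓘(ℝ, E) p).symm v) ∧
        F.fdist ((extChartAt 𝓘(ℝ, E) p).symm u) ((extChartAt 𝓘(ℝ, E) p).symm v) ≤
          (1 + η) * F.toFun p (v - u : E) := by
  have hN : IsMinkowskiNorm (V := E) (F.toFun p) := F.minkowski p
  obtain ⟨R₀, hR₀, htgt, hF⟩ := F.exists_chart_ball p hη univ_mem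
  obtain ⟨a, b, ha, hb, hab⟩ := hN.exists_bounds
  set φ := extChartAt 𝓘(ℝ, E) p with hφ
  set N : E → ℝ := F.toFun p with hNdef
  -- For `u`, `v` in the `R`-ball, `N (v - u) ≤ 2 * b * R ≤ a * R₀ / 2`, while the `N`-ball of
  -- radius `a * R₀ / 2` about `u` stays in the `R₀`-ball. A curve that leaves this `N`-ball thus
  -- already satisfies the bound.
  set R := min (R₀ / 2) (a * R₀ / (4 * b)) with hRdef
  have hRR : R ≤ R₀ / 2 := min_le_left _ _
  have hRb : b * (2 * R) ≤ a * R₀ / 2 := by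
    have : R ≤ a * R₀ / (4 * b) := min_le_right _ _
    rw [le_div_iff₀ (by positivity)] at this
    linarith
  have hball : Metric.ball (φ p) R ⊆ Metric.ball (φ p) R₀ := Metric.ball_subset_ball (by linarith)
  have hη' : 0 < 1 - η := by linarith
  refine ⟨R, by positivity, hball.trans htgt, fun u hu v hv => ⟨?_, ?_⟩⟩
  · refine F.le_fdist fun γ hγ h0 h1 => ?_
    have hφ0 : φ (γ 0) = u := by rw [h0, φ.right_inv (htgt (hball hu))]
    have hφ1 : φ (γ 1) = v := by rw [h1, φ.right_inv (htgt (hball hv))]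
    have hsrc : γ 0 ∈ (chartAt E p).source := by
      rw [← extChartAt_source 𝓘(ℝ, E), h0]; exact φ.map_target (htgt (hball hu))
    have hmem : ∀ u', N (u' - φ (γ 0)) ≤ a * R₀ / 2 → u' ∈ Metric.ball (φ p) R₀ := by
      intro u' hu'
      rw [hφ0] at hu'
      have h2 : ‖u' - u‖ ≤ R₀ / 2 := by
        have := (hab (u' - u)).1.trans hu'
        rw [mul_div_assoc] at this
        exact le_of_mul_le_mul_left this ha
      rw [Metric.mem_ball] at hu ⊢
      have h3 := dist_triangle u' u (φ p)
      rw [dist_eq_norm u' u] at h3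
      linarith
    have key := F.displacement_le_length (p := p) hN hγ hsrc (ρ := a * R₀ / 2) (C := (1 - η)⁻¹)
      (by positivity) (by positivity) (fun u' hu' => htgt (hmem u' hu')) (by
        intro z hz hzρ w
        have h4 := ((hF _ (hmem _ hzρ)).2 w).1
        rw [φ.left_inv (by rw [extChartAt_source]; exact hz)] at h4
        rwa [inv_mul_eq_div, le_div_iff₀ hη', mul_comm])
    have hfin : N (v - u) ≤ (1 - η)⁻¹ * F.length γ 0 1 := by
      rcases key with ⟨-, h⟩ | h
      · change N (φ (γ 1) - φ (γ 0)) ≤ _ at h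
        rwa [hφ0, hφ1] at h
      · refine le_trans ?_ h
        refine (hab _).2.trans (le_trans ?_ hRb)
        refine mul_le_mul_of_nonneg_left ?_ hb.le
        rw [← dist_eq_norm]
        rw [Metric.mem_ball] at hu hv
        linarith [dist_triangle_right v u (φ p)]
    rw [inv_mul_eq_div, le_div_iff₀ hη'] at hfin
    linarith
  · exact F.fdist_chart_le (hball.trans htgt) hu hv fun z hz => ((hF z (hball hz)).2 _).2

/-- Small Finsler balls are small in the topology of the manifold. -/
theorem exists_openBall_subset (p : M) {U : Set M} (hU : U ∈ 𝓝 p) :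
    ∃ r > 0, openBall F.fdist p r ⊆ U := by
  have hN : IsMinkowskiNorm (V := E) (F.toFun p) := F.minkowski p
  obtain ⟨R₀, hR₀, htgt, hF⟩ := F.exists_chart_ball p (η := 1 / 2) (by norm_num) hU
  obtain ⟨a, b, ha, hb, hab⟩ := hN.exists_bounds
  set φ := extChartAt 𝓘(ℝ, E) p with hφ
  set N : E → ℝ := F.toFun p with hNdef
  have hmem : ∀ u, N (u - φ p) ≤ a * R₀ / 2 → u ∈ Metric.ball (φ p) R₀ := by
    intro u hu
    have h2 : ‖u - φ p‖ ≤ R₀ / 2 := by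
      have := (hab (u - φ p)).1.trans hu
      rw [mul_div_assoc] at this
      exact le_of_mul_le_mul_left this ha
    rw [Metric.mem_ball, dist_eq_norm]
    linarith
  -- With comparison factor `2`, leaving the `N`-ball of radius `a * R₀ / 2` costs length at least
  -- `a * R₀ / 4`.
  refine ⟨a * R₀ / 4, by positivity, fun y hy => ?_⟩
  by_contra hyU
  refine not_le.2 (show F.fdist p y < a * R₀ / 4 from hy) (F.le_fdist ?_)
  rintro γ hγ rfl rfl
  have key := F.displacement_le_length (p := γ 0) hN hγ (mem_chart_source E _) (ρ := a * R₀ / 2)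
    (C := 2) (by positivity) (by positivity) (fun u' hu' => htgt (hmem u' hu')) (by
      intro z hz hzρ w
      have h4 := ((hF _ (hmem _ hzρ)).2 w).1
      rw [φ.left_inv (by rw [extChartAt_source]; exact hz)] at h4
      change N w ≤ 2 * F.chartNorm (γ 0) z w
      change (1 - 1 / 2) * N w ≤ _ at h4
      linarith)
  rcases key with ⟨hs, h⟩ | h
  · change N (φ (γ 1) - φ (γ 0)) ≤ _ at h
    by_contra hlt
    have h5 := (hF _ (hmem (φ (γ 1)) (by linarith))).1
    rw [φ.left_inv (by rw [extChartAt_source]; exact hs)] at h5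
    exact hyU h5
  · linarith

/-- Every Finsler ball contains a point other than its centre. -/
theorem exists_ne_mem_openBall [Nontrivial E] (p : M) {r : ℝ} (hr : 0 < r) :
    ∃ y ∈ openBall F.fdist p r, y ≠ p := by
  have hN : IsMinkowskiNorm (V := E) (F.toFun p) := F.minkowski p
  obtain ⟨R, hR, htgt, hF⟩ := F.exists_fdist_bounds p (η := 1 / 2) (by norm_num) (by norm_num)
  obtain ⟨a, b, ha, hb, hab⟩ := hN.exists_bounds
  set φ := extChartAt 𝓘(ℝ, E) p with hφ
  obtain ⟨w, hw⟩ := NormedSpace.exists_lt_norm ℝ E 0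
  set s := min (R / 2) (r / (2 * b)) with hs
  have hspos : 0 < s := by positivity
  set w' : E := (s / ‖w‖) • w with hw'
  have hnorm : ‖w'‖ = s := by
    rw [hw', norm_smul, Real.norm_of_nonneg (by positivity), div_mul_cancel₀ _ hw.ne']
  have hp : φ p ∈ Metric.ball (φ p) R := Metric.mem_ball_self hR
  have hmem : φ p + w' ∈ Metric.ball (φ p) R := by
    rw [Metric.mem_ball, dist_eq_norm, add_sub_cancel_left, hnorm]
    exact (min_le_left _ _).trans_lt (by linarith)
  refine ⟨φ.symm (φ p + w'), ?_, fun h => ?_⟩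
  · have h1 := (hF _ hp _ hmem).2
    rw [φ.left_inv (mem_extChartAt_source p), add_sub_cancel_left] at h1
    have h2 : F.toFun p w' ≤ b * ‖w'‖ := (hab w').2
    have h3 : s ≤ r / (2 * b) := min_le_right _ _
    rw [hnorm] at h2
    rw [le_div_iff₀ (by positivity)] at h3
    change F.fdist p _ < r
    nlinarith
  · have h1 := φ.right_inv (htgt hmem)
    rw [h, left_eq_add] at h1
    rw [h1, norm_zero] at hnorm
    exact hspos.ne hnorm

/-- `C¹` functions are locally Lipschitz with respect to the Finsler distance. -/
theorem exists_locally_lipschitz {h : M → ℝ} (hh : ContMDiff 𝓘(ℝ, E) 𝓘(ℝ, ℝ) 1 h) (p : M) :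
    ∃ C : ℝ, 0 ≤ C ∧ ∃ V ∈ 𝓝 p, ∀ y ∈ V, ∀ z ∈ V, |h y - h z| ≤ C * F.fdist y z := by
  have : IsManifold 𝓘(ℝ, E) 1 M := .of_le (n := ∞) (by norm_num)
  have hN : IsMinkowskiNorm (V := E) (F.toFun p) := F.minkowski p
  obtain ⟨R, hR, htgt, hF⟩ := F.exists_fdist_bounds p (η := 1 / 2) (by norm_num) (by norm_num)
  obtain ⟨a, b, ha, hb, hab⟩ := hN.exists_bounds
  set φ := extChartAt 𝓘(ℝ, E) p with hφ
  have hcd : ContDiffAt ℝ 1 (h ∘ φ.symm) (φ p) := by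
    refine ContMDiffAt.contDiffAt ?_
    exact (hh.contMDiffAt).comp (φ p) ((contMDiffOn_extChartAt_symm (I := 𝓘(ℝ, E)) p).contMDiffAt
      (extChartAt_target_mem_nhds p))
  obtain ⟨K, t, ht, hK⟩ := hcd.exists_lipschitzOnWith
  refine ⟨K * (2 / a), by positivity, φ.source ∩ φ ⁻¹' (t ∩ Metric.ball (φ p) R),
    inter_mem (extChartAt_source_mem_nhds p) ((continuousAt_extChartAt p).preimage_mem_nhds
      (inter_mem ht (Metric.ball_mem_nhds _ hR))), ?_⟩
  rintro y ⟨hy, hyt, hyR⟩ z ⟨hz, hzt, hzR⟩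
  have h1 := hK.dist_le_mul _ hyt _ hzt
  have h2 := (hF _ hyR _ hzR).1
  simp only [Function.comp, φ.left_inv hy, φ.left_inv hz] at h1 h2
  have h3 : a * ‖φ z - φ y‖ ≤ F.toFun p (φ z - φ y : E) := (hab _).1
  rw [Real.dist_eq] at h1
  refine h1.trans ?_
  rw [mul_assoc]
  refine mul_le_mul_of_nonneg_left ?_ K.2
  rw [dist_comm, dist_eq_norm, div_mul_eq_mul_div, le_div_iff₀ ha]
  linarith

/-- Finitely many local constants suffice on the support, and `h` vanishes off it. A single constant
per partition function lets the accuracy of each local approximation be fixed in advance. -/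
theorem exists_uniform_locally_lipschitz {h : M → ℝ} (hh : ContMDiff 𝓘(ℝ, E) 𝓘(ℝ, ℝ) 1 h)
    (hc : HasCompactSupport h) :
    ∃ C : ℝ, 0 ≤ C ∧ ∀ p, ∃ V ∈ 𝓝 p, ∀ y ∈ V, ∀ z ∈ V, |h y - h z| ≤ C * F.fdist y z := by
  choose C hC V hV hlip using F.exists_locally_lipschitz hh
  obtain ⟨T, -, hT⟩ := hc.isCompact.elim_nhds_subcover (fun p => interior (V p))
    fun p _ => interior_mem_nhds.2 (hV p)
  refine ⟨∑ p ∈ T, C p, Finset.sum_nonneg fun p _ => hC p, fun p => ?_⟩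
  by_cases hp : p ∈ tsupport h
  · obtain ⟨q, hq, hpq⟩ := mem_iUnion₂.1 (hT hp)
    refine ⟨V q, mem_interior_iff_mem_nhds.1 hpq, fun y hy z hz => (hlip q y hy z hz).trans ?_⟩
    exact mul_le_mul_of_nonneg_right (Finset.single_le_sum (f := C) (fun p _ => hC p) hq)
      (F.fdist_nonneg y z)
  · refine ⟨(tsupport h)ᶜ, (isClosed_tsupport h).isOpen_compl.mem_nhds hp, fun y hy z hz => ?_⟩
    rw [image_eq_zero_of_notMem_tsupport hy, image_eq_zero_of_notMem_tsupport hz, sub_self, abs_zero]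
    exact mul_nonneg (Finset.sum_nonneg fun p _ => hC p) (F.fdist_nonneg y z)

/-- Local `C¹` approximation of a Lipschitz function, with control of the Lipschitz constants. -/
theorem exists_local_approximation {f : M → ℝ} {K : ℝ} (hK : 0 ≤ K)
    (hf : ∀ x y, |f x - f y| ≤ K * F.fdist x y) {δ lam : ℝ} (hδ : 0 < δ) (hlam : 0 < lam) (p : M) :
    ∃ U : Set M, IsOpen U ∧ p ∈ U ∧ (∃ Q, IsCompact Q ∧ U ⊆ Q) ∧ ∀ ε > 0, ∃ k : M → ℝ,
      ContMDiffOn 𝓘(ℝ, E) 𝓘(ℝ, ℝ) 1 k U ∧ (∀ x ∈ U, |k x - f x| ≤ ε) ∧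
      (∀ x ∈ U, ∀ L, 0 ≤ L → L ≤ K →
        (∀ y ∈ openBall F.fdist x δ, ∀ z ∈ openBall F.fdist x δ, |f y - f z| ≤ L * F.fdist y z) →
        ∀ y ∈ U, ∀ z ∈ U, |k y - k z| ≤ (L + lam) * F.fdist y z) ∧
      ∀ x ∈ U, k x ≠ 0 → ∃ y, f y ≠ 0 ∧ ∀ x' ∈ U, F.fdist y x' < δ := by
  have hN : IsMinkowskiNorm (V := E) (F.toFun p) := F.minkowski p
  -- The inequality `hηL` amounts to `η * (2 * L + lam) ≤ lam`, which this choice gives for every `L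
  -- ≤ K`.
  set η := lam / (2 * K + 2 * lam) with hηdef
  have hη : 0 < η := by positivity
  have hη2 : η ≤ 1 / 2 := by
    rw [hηdef, div_le_iff₀ (by positivity)]; linarith
  have hηL : ∀ L, L ≤ K → (1 + η) * L ≤ (1 - η) * (L + lam) := by
    intro L hL
    have h1 : η * (2 * K + 2 * lam) = lam := div_mul_cancel₀ _ (by positivity)
    nlinarith
  obtain ⟨R₀, hR₀, htgt₀, hF₀⟩ := F.exists_fdist_bounds p hη (by linarith)
  obtain ⟨a, b, ha, hb, hab⟩ := hN.exists_bounds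
  set φ := extChartAt 𝓘(ℝ, E) p with hφ
  set N : E → ℝ := F.toFun p with hNdef
  -- This bounds Finsler distances within the chart ball by `4 * b * R ≤ δ / 2`, so the ball lies in
  -- the `δ`-ball of each of its points.
  set R := min R₀ (δ / (8 * b)) with hRdef
  have hR : 0 < R := by positivity
  have hsub : Metric.ball (φ p) R ⊆ Metric.ball (φ p) R₀ :=
    Metric.ball_subset_ball (min_le_left _ _)
  have htgt := hsub.trans htgt₀
  have hF : ∀ u ∈ Metric.ball (φ p) R, ∀ v ∈ Metric.ball (φ p) R,
      (1 - η) * N (v - u) ≤ F.fdist (φ.symm u) (φ.symm v) ∧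
        F.fdist (φ.symm u) (φ.symm v) ≤ (1 + η) * N (v - u) :=
    fun u hu v hv => hF₀ u (hsub hu) v (hsub hv)
  have hFb : ∀ u ∈ Metric.ball (φ p) R, ∀ v ∈ Metric.ball (φ p) R,
      F.fdist (φ.symm u) (φ.symm v) ≤ 2 * b * ‖v - u‖ := by
    intro u hu v hv
    have h1 := (hF u hu v hv).2
    have h2 := (hab (v - u)).2
    have h3 := hN.nonneg (v - u)
    nlinarith
  have hFδ : ∀ u ∈ Metric.ball (φ p) R, ∀ v ∈ Metric.ball (φ p) R,
      F.fdist (φ.symm u) (φ.symm v) < δ := by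
    intro u hu v hv
    have h1 := hFb u hu v hv
    have h2 : ‖v - u‖ ≤ 2 * R := by
      rw [← dist_eq_norm]
      rw [Metric.mem_ball] at hu hv
      linarith [dist_triangle_right v u (φ p)]
    have h3 : R ≤ δ / (8 * b) := min_le_right _ _
    rw [le_div_iff₀ (by positivity)] at h3
    have h4 := mul_le_mul_of_nonneg_left h2 (by positivity : 0 ≤ 2 * b)
    linarith
  -- Half the radius leaves room for the shifts by `w` in the mollification. `U` does not depend on
  -- `ε`, so the cover can be fixed before the accuracies.
  set U : Set M := φ.source ∩ φ ⁻¹' Metric.ball (φ p) (R / 2) with hU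
  have hUsub : ∀ {x}, x ∈ U → φ x ∈ Metric.ball (φ p) R := fun hx =>
    Metric.ball_subset_ball (by linarith) hx.2
  refine ⟨U, (continuousOn_extChartAt p).isOpen_inter_preimage (isOpen_extChartAt_source p)
      Metric.isOpen_ball, ⟨mem_extChartAt_source p, Metric.mem_ball_self (by linarith)⟩,
      ⟨φ.symm '' Metric.closedBall (φ p) (R / 2), (isCompact_closedBall _ _).image_of_continuousOn
        ((continuousOn_extChartAt_symm p).mono
          ((Metric.closedBall_subset_ball (by linarith)).trans htgt)), fun x hx =>
          ⟨φ x, Metric.ball_subset_closedBall hx.2, φ.left_inv hx.1⟩⟩, fun ε hε => ?_⟩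
  have hlipOn : LipschitzOnWith (K * (2 * b)).toNNReal (f ∘ φ.symm) (Metric.ball (φ p) R) := by
    refine LipschitzOnWith.of_dist_le_mul fun u hu v hv => ?_
    rw [Real.coe_toNNReal _ (by positivity), Real.dist_eq, mul_assoc, dist_comm, dist_eq_norm]
    exact (hf _ _).trans (mul_le_mul_of_nonneg_left (hFb u hu v hv) hK)
  -- The extension only makes the convolution meaningful on all of `E`; over `U` it sees values of
  -- `f` alone.
  obtain ⟨h, hlip, heq⟩ := hlipOn.extend_real
  set r := min (R / 2) (ε / (K * (2 * b) + 1)) with hr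
  have hrpos : 0 < r := by positivity
  obtain ⟨k, hk, hk1, hk2⟩ := exists_mollification hlip.continuous hrpos
  have hshift : ∀ {x}, x ∈ U → ∀ w ∈ Metric.ball (0 : E) r, φ x - w ∈ Metric.ball (φ p) R := by
    intro x hx w hw
    have h1 := hx.2
    rw [mem_preimage, Metric.mem_ball, dist_eq_norm] at h1
    rw [mem_ball_zero_iff] at hw
    rw [Metric.mem_ball, dist_eq_norm, sub_right_comm]
    have h2 := norm_sub_le (φ x - φ p) w
    have h3 : r ≤ R / 2 := min_le_left _ _
    linarith
  refine ⟨k ∘ φ, ?_, fun x hx => ?_, fun x hx L hL hLK hLip y hy z hz => ?_, fun x hx hkx => ?_⟩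
  · have : IsManifold 𝓘(ℝ, E) 1 M := .of_le (n := ∞) (by norm_num)
    refine hk.contMDiff.comp_contMDiffOn ((contMDiffOn_extChartAt (x := p)).mono fun x hx => ?_)
    rw [← extChartAt_source 𝓘(ℝ, E)]
    exact hx.1
  · have hfx : f x = h (φ x) := by
      rw [← heq (hUsub hx), Function.comp, φ.left_inv hx.1]
    rw [hfx]
    refine hk1 _ _ _ fun w hw => ?_
    have h1 := hlip.dist_le_mul (φ x - w) (φ x)
    rw [Real.coe_toNNReal _ (by positivity), Real.dist_eq, dist_eq_norm, sub_sub_cancel_left,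
      norm_neg] at h1
    rw [mem_ball_zero_iff] at hw
    have h3 : r ≤ ε / (K * (2 * b) + 1) := min_le_right _ _
    rw [le_div_iff₀ (by positivity)] at h3
    have h4 := mul_le_mul_of_nonneg_left hw.le (by positivity : 0 ≤ K * (2 * b))
    linarith
  · refine hk2 _ _ _ fun w hw => ?_
    have hyw := hshift hy w hw
    have hzw := hshift hz w hw
    rw [← heq hyw, ← heq hzw]
    have hmem : ∀ u ∈ Metric.ball (φ p) R, φ.symm u ∈ openBall F.fdist x δ := fun u hu => by
      have := hFδ _ (hUsub hx) u hu
      rwa [φ.left_inv hx.1] at this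
    have h1 := hLip _ (hmem _ hyw) _ (hmem _ hzw)
    have h2 := (hF _ hyw _ hzw).2
    -- Translation invariance: the shift by `w` cancels, so the shifted and unshifted pairs have the
    -- same `N`-distance.
    rw [sub_sub_sub_cancel_right] at h2
    have h3 := (hF _ (hUsub hy) _ (hUsub hz)).1
    rw [φ.left_inv hy.1, φ.left_inv hz.1] at h3
    refine h1.trans ((mul_le_mul_of_nonneg_left h2 hL).trans ?_)
    have h4 := mul_le_mul_of_nonneg_right (hηL L hLK) (hN.nonneg (φ z - φ y))
    have h5 := mul_le_mul_of_nonneg_left h3 (by linarith : 0 ≤ L + lam)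
    linarith
  -- Otherwise `h` vanishes at every point averaged in `k (φ x)`: all of these are within `δ` of
  -- every point of `U`.
  · by_contra! hcon
    refine hkx ?_
    have h1 := hk1 (φ x) 0 0 fun w hw => ?_
    · simpa using h1
    have hxw := hshift hx w hw
    rw [← heq hxw, sub_zero, abs_nonpos_iff, Function.comp]
    by_contra hne
    obtain ⟨x', hx', hle⟩ := hcon _ hne
    have h2 := hFδ _ hxw _ (hUsub hx')
    rw [φ.left_inv hx'.1] at h2
    exact not_lt.2 hle h2

end FinslerStructure

end Local

/-! ### Passing between Lipschitz constants and inequalities -/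

section LipschitzConstants

variable {X : Type*} {d : X → X → ℝ} {f : X → ℝ}

theorem lipConst_le {S : Set X} {C : ℝ} (hC : 0 ≤ C) (hd : ∀ x y, 0 ≤ d x y)
    (h : ∀ y ∈ S, ∀ z ∈ S, |f y - f z| ≤ C * d y z) : lipConst d f S ≤ ENNReal.ofReal C :=
  iSup₂_le fun y hy => iSup₂_le fun z hz => iSup_le fun _ =>
    ENNReal.ofReal_le_ofReal (div_le_of_le_mul₀ (hd y z) hC (h y hy z hz))

/-- The bound `hf` covers distinct points with `d y z = 0`, where the quotient defaults to `0` and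
carries no information. -/
theorem abs_sub_le_toReal_lipConst {S : Set X} {K : ℝ} (hd : ∀ x y, 0 ≤ d x y)
    (hf : ∀ y z, |f y - f z| ≤ K * d y z) (hS : lipConst d f S ≠ ⊤) {y z : X} (hy : y ∈ S)
    (hz : z ∈ S) : |f y - f z| ≤ (lipConst d f S).toReal * d y z := by
  rcases eq_or_ne y z with rfl | hyz
  · simpa using mul_nonneg ENNReal.toReal_nonneg (hd y y)
  rcases (hd y z).eq_or_lt with h0 | hpos
  · have := hf y z
    rwa [← h0, mul_zero] at this ⊢
  · rw [← div_le_iff₀ hpos]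
    have h1 : ENNReal.ofReal (|f y - f z| / d y z) ≤ lipConst d f S :=
      le_iSup₂_of_le y hy (le_iSup₂_of_le z hz (le_iSup_of_le hyz le_rfl))
    exact (ENNReal.ofReal_le_iff_le_toReal hS).1 h1

end LipschitzConstants

/-! ### Gluing by a partition of unity -/

section Global

variable {E : Type*} [NormedAddCommGroup E] [NormedSpace ℝ E] [FiniteDimensional ℝ E]
  {M : Type*} [TopologicalSpace M] [ChartedSpace E M] [IsManifold 𝓘(ℝ, E) ∞ M]
  [T2Space M] [ConnectedSpace M] (F : FinslerStructure E M)

namespace FinslerStructure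

/-- Positive dimension excludes isolated points, hence the value `⊤`, and `V` contains a Finsler
ball. -/
theorem asympLip_le [Nontrivial E] {g : M → ℝ} {x : M} {C : ℝ} (hC : 0 ≤ C) {V : Set M}
    (hV : V ∈ 𝓝 x) (h : ∀ y ∈ V, ∀ z ∈ V, |g y - g z| ≤ C * F.fdist y z) :
    asympLip F.fdist g x ≤ ENNReal.ofReal C := by
  obtain ⟨r, hr, hrV⟩ := F.exists_openBall_subset x hV
  rw [asympLip, if_pos fun r hr => F.exists_ne_mem_openBall x hr]
  exact iInf₂_le_of_le r hr <| lipConst_le hC F.fdist_nonneg fun y hy z hz =>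
    h y (hrV hy) z (hrV hz)

/-- `L` is quantified after `g` and `x`, since the Lipschitz constant of `f` on the `δ`-ball varies
with `x`. -/
theorem exists_contMDiff_approximation [SecondCountableTopology M] {f : M → ℝ} {K : ℝ}
    (hK : 0 ≤ K) (hf : ∀ x y, |f x - f y| ≤ K * F.fdist x y) {δ ε lam : ℝ} (hδ : 0 < δ)
    (hε : 0 < ε) (hlam : 0 < lam) :
    ∃ g : M → ℝ, ContMDiff 𝓘(ℝ, E) 𝓘(ℝ, ℝ) 1 g ∧ tsupport g ⊆ nbhd F.fdist (tsupport f) δ ∧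
      ∀ x : M, |g x - f x| ≤ ε ∧ ∀ L, 0 ≤ L → L ≤ K →
        (∀ y ∈ openBall F.fdist x δ, ∀ z ∈ openBall F.fdist x δ, |f y - f z| ≤ L * F.fdist y z) →
        ∃ V ∈ 𝓝 x, ∀ y ∈ V, ∀ z ∈ V, |g y - g z| ≤ (L + lam) * F.fdist y z := by
  have : LocallyCompactSpace M := Manifold.locallyCompact_of_finiteDimensional 𝓘(ℝ, E)
  choose U hUo hpU hUc hU using
    F.exists_local_approximation hK hf hδ (half_pos hlam)
  obtain ⟨s, hs, hcov⟩ := TopologicalSpace.countable_cover_nhds fun p => (hUo p).mem_nhds (hpU p)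
  have : Countable s := hs.to_subtype
  obtain ⟨ρ, hρ⟩ := SmoothPartitionOfUnity.exists_isSubordinate 𝓘(ℝ, E) (isClosed_univ (X := M))
    (fun i : s => U i) (fun i => hUo i) (by rw [← hcov, biUnion_eq_iUnion])
  have hρ1 : ∀ i, ContMDiff 𝓘(ℝ, E) 𝓘(ℝ, ℝ) 1 (ρ i) := fun i =>
    (ρ i).contMDiff.of_le (by norm_num)
  have hρc : ∀ i, HasCompactSupport (ρ i) := fun i => by
    obtain ⟨Q, hQ, hUQ⟩ := hUc i
    exact hQ.of_isClosed_subset (isClosed_tsupport _) ((hρ i).trans hUQ)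
  choose C hC W hW hWlip using fun i => F.exists_uniform_locally_lipschitz (hρ1 i) (hρc i)
  obtain ⟨ε', hε', c, hc, hcl⟩ := NNReal.exists_pos_sum_of_countable
    (ε := (lam / 2).toNNReal) (by simpa using hlam) s
  have hcl' : (c : ℝ) < lam / 2 := by
    rw [← Real.coe_toNNReal (lam / 2) (by positivity)]; exact_mod_cast hcl
  -- With this accuracy, `C i` times the error of `k i` is at most `ε' i`; the `+ 1` allows `C i =
  -- 0`.
  have he : ∀ i : s, 0 < min ε (ε' i / (C i + 1)) := fun i =>
    lt_min hε (div_pos (hε' i) (by linarith [hC i]))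
  choose k hk1 hk2 hk3 hk4 using fun i : s => hU i _ (he i)
  have hCe : ∀ i, C i * min ε (ε' i / (C i + 1)) ≤ ε' i := by
    intro i
    have h1 : min ε (ε' i / (C i + 1)) * (C i + 1) ≤ ε' i :=
      (le_div_iff₀ (by linarith [hC i])).1 (min_le_right _ _)
    linarith [he i]
  have hsum : ∀ T : Finset s, ∑ i ∈ T, (ε' i : ℝ) ≤ lam / 2 := fun T =>
    (sum_le_hasSum T (fun i _ => (ε' i).2) (NNReal.hasSum_coe.2 hc)).trans hcl'.le
  have hmemU : ∀ {i y}, ρ i y ≠ 0 → y ∈ U i := fun {i y} hy => hρ i (subset_tsupport _ hy)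
  refine ⟨fun x => ∑ᶠ i, ρ i x • k i x, ?_, fun x hx => ?_, fun x => ⟨?_, fun L hL hLK hLip => ?_⟩⟩
  · exact ρ.contMDiff_finsum_smul fun i x hx => (hk1 i).contMDiffAt ((hUo i).mem_nhds (hρ i hx))
  -- Near `x` only those `ρ i` whose closed support contains `x` are active, so `x` itself lies in
  -- `U i` and `hk4` applies to it.
  · obtain ⟨y, hyT, hy⟩ := mem_closure_iff_nhds.1 hx _ (ρ.eventually_finsupport_subset x)
    obtain ⟨i, hi⟩ : ∃ i, ρ i y • k i y ≠ 0 := by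
      by_contra! hcon
      exact hy (finsum_eq_zero_of_forall_eq_zero hcon)
    have hρi : ρ i y ≠ 0 := fun h => hi (by rw [h, zero_smul])
    have hki : k i y ≠ 0 := fun h => hi (by rw [h, smul_zero])
    obtain ⟨y', hy', hlt⟩ := hk4 i y (hmemU hρi) hki
    have hxi : x ∈ tsupport (ρ i) :=
      (ρ.mem_fintsupport_iff x i).1 (hyT ((ρ.mem_finsupport y).2 hρi))
    exact ⟨y', subset_tsupport _ hy', hlt x (hρ i hxi)⟩
  · have h1 : ∑ᶠ i, ρ i x • k i x ∈ Metric.closedBall (f x) ε :=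
      ρ.finsum_smul_mem_convex (mem_univ x) (fun i hi => by
        rw [Metric.mem_closedBall, Real.dist_eq]
        exact (hk2 i x (hmemU hi)).trans (min_le_left _ _)) (convex_closedBall _ _)
    rwa [Metric.mem_closedBall, Real.dist_eq] at h1
  · set T := ρ.fintsupport x with hT
    have hTU : ∀ i ∈ T, x ∈ U i := fun i hi => hρ i ((ρ.mem_fintsupport_iff x i).1 hi)
    refine ⟨{y | ρ.finsupport y ⊆ T} ∩ ⋂ i ∈ T, W i x ∩ U i,
      inter_mem (ρ.eventually_finsupport_subset x) ((biInter_finset_mem T).2 fun i hi =>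
        inter_mem (hW i x) ((hUo i).mem_nhds (hTU i hi))), ?_⟩
    rintro y ⟨hyT, hyW⟩ z ⟨hzT, hzW⟩
    rw [mem_iInter₂] at hyW hzW
    have hg : ∀ {y}, ρ.finsupport y ⊆ T → ∑ᶠ i, ρ i y • k i y = ∑ i ∈ T, ρ i y * k i y := by
      intro y hy
      refine finsum_eq_sum_of_support_subset _ fun i hi => hy ?_
      exact (ρ.mem_finsupport y).2 fun h => hi (by simp [h])
    have h1 : ∀ {y}, ρ.finsupport y ⊆ T → ∑ i ∈ T, ρ i y = 1 := fun {y} hy =>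
      ρ.sum_finsupport' y (mem_univ y) hy
    -- Subtracting `f z` is free because the `ρ i` sum to one at both `y` and `z`. The first sum is
    -- an average of local increments, the second involves only approximation errors.
    have hdec : ∑ i ∈ T, ρ i y * k i y - ∑ i ∈ T, ρ i z * k i z =
        ∑ i ∈ T, ρ i y * (k i y - k i z) + ∑ i ∈ T, (ρ i y - ρ i z) * (k i z - f z) := by
      have h2 : ∑ i ∈ T, (ρ i y - ρ i z) * f z = 0 := by
        rw [← Finset.sum_mul, Finset.sum_sub_distrib, h1 hyT, h1 hzT, sub_self, zero_mul]
      rw [← sub_eq_zero, ← h2, ← Finset.sum_sub_distrib, ← Finset.sum_add_distrib,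
        ← Finset.sum_sub_distrib]
      exact Finset.sum_congr rfl fun i _ => by ring
    have hd := F.fdist_nonneg y z
    have hA : |∑ i ∈ T, ρ i y * (k i y - k i z)| ≤ (L + lam / 2) * F.fdist y z := by
      calc |∑ i ∈ T, ρ i y * (k i y - k i z)| ≤ ∑ i ∈ T, |ρ i y * (k i y - k i z)| :=
            Finset.abs_sum_le_sum_abs _ _
        _ ≤ ∑ i ∈ T, ρ i y * ((L + lam / 2) * F.fdist y z) := by
            refine Finset.sum_le_sum fun i hi => ?_
            rw [abs_mul, abs_of_nonneg (ρ.nonneg i y)]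
            exact mul_le_mul_of_nonneg_left (hk3 i x (hTU i hi) L hL hLK hLip y (hyW i hi).2 z
              (hzW i hi).2) (ρ.nonneg i y)
        _ = (L + lam / 2) * F.fdist y z := by rw [← Finset.sum_mul, h1 hyT, one_mul]
    have hB : |∑ i ∈ T, (ρ i y - ρ i z) * (k i z - f z)| ≤ lam / 2 * F.fdist y z := by
      calc |∑ i ∈ T, (ρ i y - ρ i z) * (k i z - f z)|
          ≤ ∑ i ∈ T, |(ρ i y - ρ i z) * (k i z - f z)| := Finset.abs_sum_le_sum_abs _ _
        _ ≤ ∑ i ∈ T, ε' i * F.fdist y z := by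
            refine Finset.sum_le_sum fun i hi => ?_
            rw [abs_mul]
            calc |ρ i y - ρ i z| * |k i z - f z|
                ≤ (C i * F.fdist y z) * min ε (ε' i / (C i + 1)) :=
                  mul_le_mul (hWlip i x y (hyW i hi).1 z (hzW i hi).1) (hk2 i z (hzW i hi).2)
                    (abs_nonneg _) (mul_nonneg (hC i) hd)
              _ = (C i * min ε (ε' i / (C i + 1))) * F.fdist y z := by ring
              _ ≤ ε' i * F.fdist y z := mul_le_mul_of_nonneg_right (hCe i) hd
        _ ≤ lam / 2 * F.fdist y z := by
            rw [← Finset.sum_mul]; exact mul_le_mul_of_nonneg_right (hsum T) hd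
    beta_reduce
    rw [hg hyT, hg hzT, hdec]
    have h3 := abs_add_le (∑ i ∈ T, ρ i y * (k i y - k i z))
      (∑ i ∈ T, (ρ i y - ρ i z) * (k i z - f z))
    linarith

end FinslerStructure

end Global
end

theorem mainTheorem3 {E : Type*} [NormedAddCommGroup E] [NormedSpace ℝ E]
    [FiniteDimensional ℝ E] [Nontrivial E]
    {M : Type*} [TopologicalSpace M] [T2Space M] [SecondCountableTopology M] [ConnectedSpace M]
    [ChartedSpace E M] [IsManifold 𝓘(ℝ, E) ∞ M]
    (F : FinslerStructure E M) (hrev : F.Reversible) (hcomplete : F.GeodesicallyComplete)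
    (f : M → ℝ) (hf : IsLipschitz F.fdist f)
    (δ ε lam : ℝ) (hδ : 0 < δ) (hε : 0 < ε) (hlam : 0 < lam) :
    ∃ g : M → ℝ, ContMDiff 𝓘(ℝ, E) 𝓘(ℝ, ℝ) 1 g ∧
      tsupport g ⊆ nbhd F.fdist (tsupport f) δ ∧
      ∀ x : M, |g x - f x| ≤ ε ∧
        asympLip F.fdist g x ≤ lipConst F.fdist f (openBall F.fdist x δ) + ENNReal.ofReal lam := by
  obtain ⟨K', hK'⟩ := hf
  -- `IsLipschitz` does not require its constant to be nonnegative.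
  have hK : ∀ x y, |f x - f y| ≤ max K' 0 * F.fdist x y := fun x y =>
    (hK' x y).trans (mul_le_mul_of_nonneg_right (le_max_left _ _) (F.fdist_nonneg x y))
  obtain ⟨g, hg, hsupp, happ⟩ :=
    F.exists_contMDiff_approximation (le_max_right K' 0) hK hδ hε hlam
  refine ⟨g, hg, hsupp, fun x => ⟨(happ x).1, ?_⟩⟩
  have hle : lipConst F.fdist f (openBall F.fdist x δ) ≤ ENNReal.ofReal (max K' 0) :=
    lipConst_le (le_max_right _ _) F.fdist_nonneg fun y _ z _ => hK y z
  have htop := ne_top_of_le_ne_top ENNReal.ofReal_ne_top hle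
  obtain ⟨V, hV, hVlip⟩ := (happ x).2 _ ENNReal.toReal_nonneg
    (ENNReal.toReal_le_of_le_ofReal (le_max_right _ _) hle)
    fun y hy z hz => abs_sub_le_toReal_lipConst F.fdist_nonneg hK htop hy hz
  refine (F.asympLip_le (add_nonneg ENNReal.toReal_nonneg hlam.le) hV hVlip).trans ?_
  rw [ENNReal.ofReal_add ENNReal.toReal_nonneg hlam.le, ENNReal.ofReal_toReal htop]
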